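/- For $x>0$ let $\mathrm{si}(x)=-\int_x^\infty \frac{\sin t}{t}\,dt$ and $\mathrm{Ci}(x)=-\int_x^\infty \frac{\cos t}{t}\,dt$ (convergent improper integrals, i.e. limits of $\int_x^T$ as $T\to\infty$). All infinite series below are limits of their partial sums, and their convergence is part of the claim. Let $a>0$. (i) For every integer $n\ge 1$, $$\int_0^1 \log\Gamma(x+a)\sin(2n\pi x)\,dx=-\frac{1}{2n\pi}\bigl[\log a-\cos(2n\pi a)\,\mathrm{Ci}(2n\pi a)-\sin(2n\pi a)\,\mathrm{si}(2n\pi a)\bigr],$$ $$\int_0^1 \log\Gamma(x+a)\cos(2n\pi x)\,dx=-\frac{1}{2n\pi}\bigl[-\sin(2n\pi a)\,\mathrm{Ci}(2n\pi a)+\cos(2n\pi a)\,\mathrm{si}(2n\pi a)\bigr].$$ (ii) $\log\Gamma(x)$ and $\log\Gamma(a+x)$ are integrable on $[0,1]$, with $$\int_0^1\log\Gamma(x)\,dx=\tfrac12\log(2\pi),\qquad \int_0^1\log\Gamma(a+x)\,dx=\tfrac12\log(2\pi)+a\log a-a.$$ (iii) For every $0<x<1$, $$\log\Gamma(a+x)=\tfrac12\log(2\pi)+a\log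 a-a-\sum_{n=1}^\infty\frac{1}{n\pi}\bigl[-\sin(2n\pi a)\,\mathrm{Ci}(2n\pi a)+\cos(2n\pi a)\,\mathrm{si}(2n\pi a)\bigr]\cos(2n\pi x)$$ $$\qquad-\sum_{n=1}^\infty\frac{1}{n\pi}\bigl[\log a-\cos(2n\pi a)\,\mathrm{Ci}(2n\pi a)-\sin(2n\pi a)\,\mathrm{si}(2n\pi a)\bigr]\sin(2n\pi x).$$ (iv) For every $0<x<1$, $$\log\Gamma(a+x)=\tfrac12\log(2\pi)+\bigl(a+x-\tfrac12\bigr)\log a-a+\sum_{n=1}^\infty\frac{\sin(2n\pi(a+x))\,\mathrm{Ci}(2n\pi a)-\cos(2n\pi(a+x))\,\mathrm{si}(2n\pi a)}{n\pi}.$$ (v) The formula in (iv) also holds at $x=0$: $$\log\Gamma(a)=\tfrac12\log(2\pi)+\bigl(a-\tfrac12\bigr)\log a-a+\sum_{n=1}^\infty\frac{\sin(2n\pi a)\,\mathrm{Ci}(2n\pi a)-\cos(2n\pi a)\,\mathrm{si}(2n\pi a)}{n\pi}.$$ -/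

import Mathlib

open Real Filter Topology

/-- The sine integral `si(x) = -∫_x^∞ (sin t)/t dt`, the improper integral being the limit of the
integrals over `[x, T]` as `T → ∞` (it is not absolutely convergent). -/
noncomputable def sinIntegral (x : ℝ) : ℝ :=
  -limUnder atTop (fun T : ℝ => ∫ t in x..T, Real.sin t / t)

/-- The cosine integral `Ci(x) = -∫_x^∞ (cos t)/t dt` for `x > 0`, the improper integral being the
limit of the integrals over `[x, T]` as `T → ∞`. -/
noncomputable def cosIntegral (x : ℝ) : ℝ :=
  -limUnder atTop (fun T : ℝ => ∫ t in x..T, Real.cos t / t)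

/-- If `g` is bounded with derivative `f`, then `∫_x^∞ f(t)/t dt` converges for `x > 0`. -/
theorem exists_tendsto_integral_div {f g : ℝ → ℝ} (hg : ∀ t, HasDerivAt g (f t) t)
    (hf : Continuous f) (hb : ∀ t, |g t| ≤ 1) {x : ℝ} (hx : 0 < x) :
    ∃ l : ℝ, Tendsto (fun T : ℝ => ∫ t in x..T, f t / t) atTop (𝓝 l) := by
  have hgc : Continuous g := continuous_iff_continuousAt.2 fun t => (hg t).continuousAt
  have hint : MeasureTheory.IntegrableOn (fun t : ℝ => g t * t ^ (-2 : ℝ)) (Set.Ioi x) := by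
    refine MeasureTheory.Integrable.bdd_mul (c := 1)
      (integrableOn_Ioi_rpow_of_lt (by norm_num) hx) hgc.aestronglyMeasurable ?_
    exact Eventually.of_forall fun t => by simpa using hb t
  have h1 := MeasureTheory.intervalIntegral_tendsto_integral_Ioi x hint tendsto_id
  have h2 : Tendsto (fun T : ℝ => g T * T⁻¹) atTop (𝓝 0) := by
    refine squeeze_zero_norm' ?_ tendsto_inv_atTop_zero
    filter_upwards [eventually_gt_atTop 0] with T hT
    rw [norm_mul, Real.norm_eq_abs, Real.norm_eq_abs, abs_of_pos (inv_pos.2 hT)]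
    exact mul_le_of_le_one_left (inv_pos.2 hT).le (hb T)
  refine ⟨_, ((h2.sub_const (g x * x⁻¹)).add h1).congr' ?_⟩
  filter_upwards [eventually_ge_atTop x] with T hT
  have hpos : ∀ t ∈ Set.uIcc x T, 0 < t := fun t ht => by
    rw [Set.uIcc_of_le hT] at ht
    exact hx.trans_le ht.1
  have hc : ContinuousOn (fun t : ℝ => f t / t) (Set.uIcc x T) :=
    hf.continuousOn.div continuousOn_id fun t ht => (hpos t ht).ne'
  have hc2 : ContinuousOn (fun t : ℝ => g t * t ^ (-2 : ℝ)) (Set.uIcc x T) :=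
    hgc.continuousOn.mul (continuousOn_id.rpow_const fun t ht => Or.inl (hpos t ht).ne')
  have key := intervalIntegral.integral_eq_sub_of_hasDerivAt
    (f := fun t => g t * t⁻¹) (f' := fun t => f t / t - g t * t ^ (-2 : ℝ)) (a := x) (b := T)
    (fun t ht => by
      refine HasDerivAt.congr_deriv ((hg t).mul (hasDerivAt_inv (hpos t ht).ne')) ?_
      rw [Real.rpow_neg (hpos t ht).le]
      norm_num
      ring) (hc.sub hc2).intervalIntegrable
  rw [intervalIntegral.integral_sub hc.intervalIntegrable hc2.intervalIntegrable] at key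
  simp only [id]
  linarith

/-- For `x > 0` the improper integral defining `si(x)` converges. -/
theorem tendsto_sinIntegral {x : ℝ} (hx : 0 < x) :
    Tendsto (fun T : ℝ => -∫ t in x..T, Real.sin t / t) atTop (𝓝 (sinIntegral x)) :=
  (tendsto_nhds_limUnder (exists_tendsto_integral_div (g := fun t => -Real.cos t)
    (fun t => HasDerivAt.congr_deriv (Real.hasDerivAt_cos t).neg (neg_neg _)) Real.continuous_sin
    (fun t => by simpa using Real.abs_cos_le_one t) hx)).neg

/-- For `x > 0` the improper integral defining `Ci(x)` converges. -/
theorem tendsto_cosIntegral {x : ℝ} (hx : 0 < x) :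
    Tendsto (fun T : ℝ => -∫ t in x..T, Real.cos t / t) atTop (𝓝 (cosIntegral x)) :=
  (tendsto_nhds_limUnder (exists_tendsto_integral_div (g := fun t => Real.sin t)
    (fun t => Real.hasDerivAt_sin t) Real.continuous_cos Real.abs_sin_le_one hx)).neg

/-!
The Fourier coefficients of `log Γ(x + a)` on `[0, 1]` come from the functional equation
`log Γ(x + 1) = log Γ(x) + log x`. Pair `log Γ(x + a)` with a `1`-periodic function `φ = Φ'`, where
`Φ` is periodic of mean zero. Telescoping replaces the pairing by that of `log Γ(x + a + N)` minus
`∫₀ᴺ log (x + a) φ(x) dx`. By log-convexity, `log Γ(x + T) = log Γ(T) + x log T + o(1)` uniformly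
for `x ∈ [0, 1]`, so the first term is `Φ(0) log (a + N) + o(1)`; integrating the second by parts
cancels this growth and leaves
`∫₀¹ log Γ(x + a) φ(x) dx = Φ(0) log a + ∫₀^∞ Φ(x) / (x + a) dx` (`tendsto_integral_div_add`).
For `Φ` a multiple of `sin (2nπx)` or `cos (2nπx)` the last integral is a combination of
`Ci (2nπa)` and `si (2nπa)`.

The mean of `log Γ` is Raabe's integral, obtained from Euler's reflection formula and the integral
of `log (sin x)` (`integral_log_Gamma_zero_one`).

For the pointwise expansions, `log Γ(x + a) - x log a` takes the same value at `0` and `1`, and its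
Fourier coefficients are `O(1/n²)`. Its Fourier series therefore converges to it at every point of
`[0, 1)`, including `0` (`tendsto_sum_log_Gamma_add`). Adding back the sawtooth series
`∑ sin (2nπx) / (nπ) = 1/2 - x` on `(0, 1)` (`tendsto_sum_sin_div_sawtooth`) gives the expansion of
`log Γ(a + x)` itself.
-/

/-! ### `log Γ` against periodic functions -/

theorem log_Gamma_add_one {x : ℝ} (hx : 0 < x) :
    log (Gamma (x + 1)) = log (Gamma x) + log x := by
  rw [Gamma_add_one hx.ne', log_mul hx.ne' (Gamma_pos_of_pos hx).ne', add_comm]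

theorem continuousOn_log_Gamma : ContinuousOn (fun x : ℝ => log (Gamma x)) (Set.Ioi 0) := by
  intro x hx
  have hx : 0 < x := hx
  refine ContinuousAt.continuousWithinAt (ContinuousAt.log ?_ (Gamma_pos_of_pos hx).ne')
  refine (differentiableAt_Gamma fun m => ?_).continuousAt
  have : (0 : ℝ) ≤ m := m.cast_nonneg
  linarith

theorem continuousOn_log_Gamma_add {a : ℝ} {s : Set ℝ} (h : ∀ x ∈ s, 0 < x + a) :
    ContinuousOn (fun x : ℝ => log (Gamma (x + a))) s :=
  continuousOn_log_Gamma.comp (f := fun x : ℝ => x + a) (by fun_prop) h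

/-- Weak form of Stirling's formula, uniform in `x`: log-convexity squeezes the slope of `log Γ` on
`[T, T + x]` between its slopes `log (T - 1)` on `[T - 1, T]` and `log T` on `[T, T + 1]`. -/
theorem abs_log_Gamma_add_sub_le {T x : ℝ} (hT : 1 < T) (h0 : 0 ≤ x) (h1 : x ≤ 1) :
    |log (Gamma (x + T)) - log (Gamma T) - x * log T| ≤ log T - log (T - 1) := by
  have hT0 : 0 < T := by linarith
  have hmono : log (T - 1) ≤ log T := log_le_log (by linarith) (by linarith)
  have hl := log_Gamma_add_one (x := T - 1) (by linarith)
  rw [sub_add_cancel] at hl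
  have hr := log_Gamma_add_one hT0
  have up := convexOn_log_Gamma.2 (x := T) (y := T + 1) hT0 (by simp; linarith)
    (sub_nonneg.2 h1) h0 (by ring)
  simp only [smul_eq_mul, Function.comp_apply] at up
  rw [show (1 - x) * T + x * (T + 1) = x + T by ring, hr] at up
  -- `T` divides `[T - 1, x + T]` in the ratio `1 : x`
  have lo := convexOn_log_Gamma.2 (show T - 1 ∈ Set.Ioi 0 by simp; linarith)
    (show x + T ∈ Set.Ioi 0 by simp; linarith) (show 0 ≤ x / (1 + x) by positivity)
    (show 0 ≤ 1 / (1 + x) by positivity) (by field_simp; ring)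
  simp only [smul_eq_mul, Function.comp_apply] at lo
  rw [show x / (1 + x) * (T - 1) + 1 / (1 + x) * (x + T) = T by field_simp; ring,
    ← sub_nonneg, show x / (1 + x) * log (Gamma (T - 1)) + 1 / (1 + x) * log (Gamma (x + T))
      - log (Gamma T) = (x * log (Gamma (T - 1)) + log (Gamma (x + T)) - (1 + x) * log (Gamma T))
        / (1 + x) by field_simp, le_div_iff₀ (by positivity)] at lo
  rw [abs_le]
  constructor <;> nlinarith

/-- The functional equation, telescoped: the integrals over `[k, k + 1]` of `log (x + a) φ(x)` are
shifted back to `[0, 1]` by periodicity of `φ`. -/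
theorem integral_log_Gamma_mul_add_nat {a : ℝ} (ha : 0 < a) {φ : ℝ → ℝ} (hφ : Continuous φ)
    (hper : Function.Periodic φ 1) (N : ℕ) :
    ∫ x in (0 : ℝ)..1, log (Gamma (x + (a + N))) * φ x =
      (∫ x in (0 : ℝ)..1, log (Gamma (x + a)) * φ x) + ∫ x in (0 : ℝ)..N, log (x + a) * φ x := by
  induction N with
  | zero => simp
  | succ N ih =>
    have hcl : ∀ u v : ℝ, 0 ≤ u → u ≤ v →
        IntervalIntegrable (fun x => log (x + a) * φ x) MeasureTheory.volume u v := by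
      intro u v hu huv
      refine ContinuousOn.intervalIntegrable (ContinuousOn.mul (ContinuousOn.log (by fun_prop) ?_)
        hφ.continuousOn)
      intro x hx
      rw [Set.uIcc_of_le huv] at hx
      linarith [hx.1]
    have hN : (0 : ℝ) ≤ N := N.cast_nonneg
    have hsplit := intervalIntegral.integral_add_adjacent_intervals (hcl 0 N le_rfl hN)
      (hcl N (N + 1) hN (by linarith))
    have hshift : ∫ x in (N : ℝ)..(N + 1), log (x + a) * φ x =
        ∫ x in (0 : ℝ)..1, log (x + (a + N)) * φ x := by
      have := intervalIntegral.integral_comp_add_right (a := 0) (b := 1)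
        (fun x => log (x + a) * φ x) (N : ℝ)
      rw [zero_add, add_comm (1 : ℝ)] at this
      rw [← this]
      refine intervalIntegral.integral_congr fun x _ => ?_
      have hp := hper.nat_mul N x
      rw [mul_one] at hp
      simp only [hp]
      ring_nf
    push_cast
    rw [← hsplit, hshift, ← add_assoc (∫ x in (0 : ℝ)..1, log (Gamma (x + a)) * φ x), ← ih,
      ← intervalIntegral.integral_add]
    · refine intervalIntegral.integral_congr fun x hx => ?_
      rw [Set.uIcc_of_le zero_le_one] at hx
      have h := log_Gamma_add_one (x := x + (a + N)) (by linarith [hx.1])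
      simp only [show x + (a + (N + 1 : ℝ)) = x + (a + N) + 1 by ring, h]
      ring
    · refine ContinuousOn.intervalIntegrable
        ((continuousOn_log_Gamma_add fun x hx => ?_).mul hφ.continuousOn)
      rw [Set.uIcc_of_le zero_le_one] at hx
      linarith [hx.1]
    · refine ContinuousOn.intervalIntegrable
        ((ContinuousOn.log (by fun_prop) fun x hx => ?_).mul hφ.continuousOn)
      rw [Set.uIcc_of_le zero_le_one] at hx
      linarith [hx.1]

/-- As `T → ∞`, only the linear part `x log T` of `log Γ(x + T)` contributes to its pairing with a
function `φ` of mean zero. -/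
theorem tendsto_integral_log_Gamma_add_mul_sub {φ : ℝ → ℝ} (hφ : Continuous φ)
    (hmean : ∫ x in (0 : ℝ)..1, φ x = 0) :
    Tendsto (fun T : ℝ => (∫ x in (0 : ℝ)..1, log (Gamma (x + T)) * φ x)
      - log T * ∫ x in (0 : ℝ)..1, x * φ x) atTop (𝓝 0) := by
  obtain ⟨M, hM⟩ := isCompact_Icc.exists_bound_of_continuousOn
    (hφ.continuousOn (s := Set.Icc (0 : ℝ) 1))
  have hlim : Tendsto (fun T : ℝ => (log T - log (T - 1)) * M) atTop (𝓝 0) := by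
    have h1 : Tendsto (fun T : ℝ => log (1 - T⁻¹)) atTop (𝓝 0) := by
      have := (tendsto_inv_atTop_zero (𝕜 := ℝ)).const_sub 1
      rw [sub_zero] at this
      simpa using this.log one_ne_zero
    have h2 := (h1.neg).mul_const M
    rw [neg_zero, zero_mul] at h2
    refine h2.congr' ?_
    filter_upwards [eventually_gt_atTop 1] with T hT
    rw [show (1 : ℝ) - T⁻¹ = (T - 1) / T by field_simp, log_div (by linarith) (by linarith)]
    ring
  refine squeeze_zero_norm' ?_ hlim
  filter_upwards [eventually_gt_atTop 1] with T hT
  have hc : IntervalIntegrable (fun x => log (Gamma (x + T)) * φ x) MeasureTheory.volume 0 1 := by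
    refine ContinuousOn.intervalIntegrable
      ((continuousOn_log_Gamma_add fun x hx => ?_).mul hφ.continuousOn)
    rw [Set.uIcc_of_le zero_le_one] at hx
    linarith [hx.1]
  have h2 : IntervalIntegrable (fun x => log (Gamma T) * φ x) MeasureTheory.volume 0 1 :=
    (by fun_prop : Continuous fun x => log (Gamma T) * φ x).intervalIntegrable _ _
  have h3 : IntervalIntegrable (fun x => log T * (x * φ x)) MeasureTheory.volume 0 1 :=
    (by fun_prop : Continuous fun x => log T * (x * φ x)).intervalIntegrable _ _
  have key : (∫ x in (0 : ℝ)..1, log (Gamma (x + T)) * φ x)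
      - log T * ∫ x in (0 : ℝ)..1, x * φ x
      = ∫ x in (0 : ℝ)..1, (log (Gamma (x + T)) - log (Gamma T) - x * log T) * φ x := by
    have : (∫ x in (0 : ℝ)..1, (log (Gamma (x + T)) - log (Gamma T) - x * log T) * φ x)
        = ∫ x in (0 : ℝ)..1,
          (log (Gamma (x + T)) * φ x - log (Gamma T) * φ x - log T * (x * φ x)) :=
      intervalIntegral.integral_congr fun x _ => by ring
    rw [this, intervalIntegral.integral_sub (hc.sub h2) h3, intervalIntegral.integral_sub hc h2,
      intervalIntegral.integral_const_mul, intervalIntegral.integral_const_mul, hmean]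
    ring
  rw [key]
  refine (intervalIntegral.norm_integral_le_of_norm_le_const
    (C := (log T - log (T - 1)) * M) fun x hx => ?_).trans (by simp)
  rw [Set.uIoc_of_le zero_le_one] at hx
  rw [norm_mul]
  exact mul_le_mul (abs_log_Gamma_add_sub_le hT hx.1.le hx.2) (hM x ⟨hx.1.le, hx.2⟩)
    (norm_nonneg _) ((abs_nonneg _).trans (abs_log_Gamma_add_sub_le hT hx.1.le hx.2))

/-- The pairing of `log Γ(x + a)` with a `1`-periodic derivative `φ = Φ'` is reduced to an improper
integral over the half-line: `log Γ(x + a)` telescopes against `log Γ(x + a + N)`, and an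
integration by parts cancels the growth in `N`. -/
theorem tendsto_integral_div_add {a : ℝ} (ha : 0 < a) {φ Φ : ℝ → ℝ}
    (hΦ : ∀ x, HasDerivAt Φ (φ x) x) (hφ : Continuous φ) (hper : Function.Periodic φ 1)
    (hperΦ : Function.Periodic Φ 1) (hmean : ∫ x in (0 : ℝ)..1, Φ x = 0) :
    Tendsto (fun N : ℕ => ∫ x in (0 : ℝ)..N, Φ x / (x + a)) atTop
      (𝓝 ((∫ x in (0 : ℝ)..1, log (Gamma (x + a)) * φ x) - Φ 0 * log a)) := by
  have hΦc : Continuous Φ := continuous_iff_continuousAt.2 fun t => (hΦ t).continuousAt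
  have hφmean : ∫ x in (0 : ℝ)..1, φ x = 0 := by
    rw [intervalIntegral.integral_eq_sub_of_hasDerivAt (fun x _ => hΦ x)
      (hφ.intervalIntegrable _ _)]
    have := hperΦ 0
    rw [zero_add] at this
    rw [this, sub_self]
  have hxφ : ∫ x in (0 : ℝ)..1, x * φ x = Φ 0 := by
    rw [intervalIntegral.integral_mul_deriv_eq_deriv_mul (u := fun x : ℝ => x) (u' := fun _ => 1)
      (fun x _ => hasDerivAt_id' x) (fun x _ => hΦ x) (by simp) (hφ.intervalIntegrable _ _)]
    have := hperΦ 0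
    rw [zero_add] at this
    simp [hmean, this]
  have hT : Tendsto (fun N : ℕ => a + (N : ℝ)) atTop atTop :=
    tendsto_atTop_add_const_left _ _ tendsto_natCast_atTop_atTop
  have hlim := ((tendsto_integral_log_Gamma_add_mul_sub hφ hφmean).comp hT).const_sub
    ((∫ x in (0 : ℝ)..1, log (Gamma (x + a)) * φ x) - Φ 0 * log a)
  rw [sub_zero] at hlim
  refine hlim.congr fun N => ?_
  have hpos : ∀ x ∈ Set.uIcc (0 : ℝ) N, 0 < x + a := fun x hx => by
    rw [Set.uIcc_of_le N.cast_nonneg] at hx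
    linarith [hx.1]
  have hparts := intervalIntegral.integral_mul_deriv_eq_deriv_mul (a := 0) (b := (N : ℝ))
    (u := fun x : ℝ => log (x + a)) (u' := fun x => (x + a)⁻¹) (v := Φ) (v' := φ)
    (fun x hx => by
      simpa using ((hasDerivAt_id' x).add_const a).log (hpos x hx).ne') (fun x _ => hΦ x)
    (ContinuousOn.intervalIntegrable (ContinuousOn.inv₀ (by fun_prop) fun x hx => (hpos x hx).ne'))
    (hφ.intervalIntegrable _ _)
  have hN : Φ N = Φ 0 := by
    have := hperΦ.nat_mul N 0
    rwa [mul_one, zero_add] at this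
  simp only [Function.comp_apply]
  rw [integral_log_Gamma_mul_add_nat ha hφ hper, hparts, hxφ, hN, zero_add, add_comm (N : ℝ) a]
  simp only [inv_mul_eq_div]
  ring

/-! ### The integrals giving `Ci` and `si` -/

theorem tendsto_integral_cos_div_add {a ω : ℝ} (ha : 0 < a) (hω : 0 < ω) :
    Tendsto (fun N : ℕ => ∫ x in (0 : ℝ)..N, cos (ω * x) / (x + a)) atTop
      (𝓝 (-(cos (ω * a) * cosIntegral (ω * a)) - sin (ω * a) * sinIntegral (ω * a))) := by
  have hT : Tendsto (fun N : ℕ => ω * (N : ℝ) + ω * a) atTop atTop :=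
    tendsto_atTop_add_const_right _ _ (tendsto_natCast_atTop_atTop.const_mul_atTop hω)
  have h := (((tendsto_cosIntegral (mul_pos hω ha)).comp hT).const_mul (-cos (ω * a))).sub
    (((tendsto_sinIntegral (mul_pos hω ha)).comp hT).const_mul (sin (ω * a)))
  rw [neg_mul] at h
  refine h.congr fun N => ?_
  have hpos : ∀ t ∈ Set.uIcc (ω * a) (ω * N + ω * a), t ≠ 0 := fun t ht => by
    rw [Set.uIcc_of_le (by have := mul_nonneg hω.le (N.cast_nonneg (α := ℝ)); linarith)] at ht
    exact ((mul_pos hω ha).trans_le ht.1).ne'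
  have hs := intervalIntegral.smul_integral_comp_mul_add (a := 0) (b := (N : ℝ))
    (fun t => cos (t - ω * a) / t) ω (ω * a)
  rw [mul_zero, zero_add, smul_eq_mul, ← intervalIntegral.integral_const_mul] at hs
  have h1 : ∫ x in (0 : ℝ)..N, cos (ω * x) / (x + a)
      = ∫ t in (ω * a)..(ω * N + ω * a), cos (t - ω * a) / t := by
    rw [← hs]
    refine intervalIntegral.integral_congr fun x _ => ?_
    simp only [add_sub_cancel_right]
    rw [← mul_add, ← mul_div_assoc, mul_div_mul_left _ _ hω.ne']
  have h2 : ∫ t in (ω * a)..(ω * N + ω * a), cos (t - ω * a) / t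
      = ∫ t in (ω * a)..(ω * N + ω * a),
        (cos (ω * a) * (cos t / t) + sin (ω * a) * (sin t / t)) :=
    intervalIntegral.integral_congr fun t _ => by simp only [cos_sub]; ring
  rw [h1, h2, intervalIntegral.integral_add, intervalIntegral.integral_const_mul,
    intervalIntegral.integral_const_mul]
  · simp only [Function.comp_apply]
    ring
  · exact ((continuousOn_cos.div continuousOn_id hpos).const_mul _).intervalIntegrable
  · exact ((continuousOn_sin.div continuousOn_id hpos).const_mul _).intervalIntegrable

theorem tendsto_integral_sin_div_add {a ω : ℝ} (ha : 0 < a) (hω : 0 < ω) :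
    Tendsto (fun N : ℕ => ∫ x in (0 : ℝ)..N, sin (ω * x) / (x + a)) atTop
      (𝓝 (sin (ω * a) * cosIntegral (ω * a) - cos (ω * a) * sinIntegral (ω * a))) := by
  have hT : Tendsto (fun N : ℕ => ω * (N : ℝ) + ω * a) atTop atTop :=
    tendsto_atTop_add_const_right _ _ (tendsto_natCast_atTop_atTop.const_mul_atTop hω)
  have h := (((tendsto_cosIntegral (mul_pos hω ha)).comp hT).const_mul (sin (ω * a))).sub
    (((tendsto_sinIntegral (mul_pos hω ha)).comp hT).const_mul (cos (ω * a)))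
  refine h.congr fun N => ?_
  have hpos : ∀ t ∈ Set.uIcc (ω * a) (ω * N + ω * a), t ≠ 0 := fun t ht => by
    rw [Set.uIcc_of_le (by have := mul_nonneg hω.le (N.cast_nonneg (α := ℝ)); linarith)] at ht
    exact ((mul_pos hω ha).trans_le ht.1).ne'
  have hs := intervalIntegral.smul_integral_comp_mul_add (a := 0) (b := (N : ℝ))
    (fun t => sin (t - ω * a) / t) ω (ω * a)
  rw [mul_zero, zero_add, smul_eq_mul, ← intervalIntegral.integral_const_mul] at hs
  have h1 : ∫ x in (0 : ℝ)..N, sin (ω * x) / (x + a)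
      = ∫ t in (ω * a)..(ω * N + ω * a), sin (t - ω * a) / t := by
    rw [← hs]
    refine intervalIntegral.integral_congr fun x _ => ?_
    simp only [add_sub_cancel_right]
    rw [← mul_add, ← mul_div_assoc, mul_div_mul_left _ _ hω.ne']
  have h2 : ∫ t in (ω * a)..(ω * N + ω * a), sin (t - ω * a) / t
      = ∫ t in (ω * a)..(ω * N + ω * a),
        (cos (ω * a) * (sin t / t) - sin (ω * a) * (cos t / t)) :=
    intervalIntegral.integral_congr fun t _ => by simp only [sin_sub]; ring
  rw [h1, h2, intervalIntegral.integral_sub, intervalIntegral.integral_const_mul,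
    intervalIntegral.integral_const_mul]
  · simp only [Function.comp_apply]
    ring
  · exact ((continuousOn_sin.div continuousOn_id hpos).const_mul _).intervalIntegrable
  · exact ((continuousOn_cos.div continuousOn_id hpos).const_mul _).intervalIntegrable

/-- A bounded primitive of the numerator bounds the integral uniformly in `T`, by one integration by
parts. -/
theorem abs_integral_deriv_div_add_le {a M T : ℝ} (ha : 0 < a) (hT : 0 ≤ T) {f g : ℝ → ℝ}
    (hg : ∀ x, HasDerivAt g (f x) x) (hf : Continuous f) (hM : ∀ x, |g x| ≤ M) :
    |∫ x in (0 : ℝ)..T, f x / (x + a)| ≤ 2 * M / a := by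
  have hgc : Continuous g := continuous_iff_continuousAt.2 fun t => (hg t).continuousAt
  have hpos : ∀ x ∈ Set.uIcc (0 : ℝ) T, 0 < x + a := fun x hx => by
    rw [Set.uIcc_of_le hT] at hx
    linarith [hx.1]
  have hinv : ∀ x ∈ Set.uIcc (0 : ℝ) T,
      HasDerivAt (fun x : ℝ => (x + a)⁻¹) (-((x + a) ^ 2)⁻¹) x := fun x hx => by
    refine (((hasDerivAt_id' x).add_const a).inv (hpos x hx).ne').congr_deriv ?_
    rw [neg_div, one_div]
  have hc : ContinuousOn (fun x : ℝ => ((x + a) ^ 2)⁻¹) (Set.uIcc 0 T) :=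
    ContinuousOn.inv₀ (by fun_prop) fun x hx => (pow_pos (hpos x hx) 2).ne'
  have hparts := intervalIntegral.integral_mul_deriv_eq_deriv_mul hinv (fun x _ => hg x)
    hc.neg.intervalIntegrable (hf.intervalIntegrable _ _)
  have hint := intervalIntegral.integral_eq_sub_of_hasDerivAt hinv hc.neg.intervalIntegrable
  have hbd : |∫ x in (0 : ℝ)..T, -((x + a) ^ 2)⁻¹ * g x| ≤ M * (a⁻¹ - (T + a)⁻¹) := by
    have := intervalIntegral.norm_integral_le_of_norm_le (μ := MeasureTheory.volume) hT
      (f := fun x => -((x + a) ^ 2)⁻¹ * g x) (g := fun x => -M * -((x + a) ^ 2)⁻¹)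
      (Eventually.of_forall fun x _ => by
        rw [norm_mul, norm_neg, norm_inv, norm_pow, Real.norm_eq_abs, sq_abs, neg_mul_neg,
          mul_comm]
        exact mul_le_mul_of_nonneg_right (hM x) (by positivity))
      (hc.neg.intervalIntegrable.const_mul _)
    rw [intervalIntegral.integral_const_mul, hint, Real.norm_eq_abs, zero_add] at this
    linarith
  have e : ∫ x in (0 : ℝ)..T, f x / (x + a) = ∫ x in (0 : ℝ)..T, (x + a)⁻¹ * f x :=
    intervalIntegral.integral_congr fun x _ => by simp only [div_eq_mul_inv, mul_comm]
  rw [e, hparts, zero_add]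
  have hTa : 0 < (T + a)⁻¹ := by positivity
  have ha' : 0 < a⁻¹ := by positivity
  have b1 : |(T + a)⁻¹ * g T| ≤ (T + a)⁻¹ * M := by
    rw [abs_mul, abs_of_pos hTa]; exact mul_le_mul_of_nonneg_left (hM T) hTa.le
  have b2 : |a⁻¹ * g 0| ≤ a⁻¹ * M := by
    rw [abs_mul, abs_of_pos ha']; exact mul_le_mul_of_nonneg_left (hM 0) ha'.le
  calc _ ≤ |(T + a)⁻¹ * g T| + |a⁻¹ * g 0| + |∫ x in (0 : ℝ)..T, -((x + a) ^ 2)⁻¹ * g x| :=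
        (abs_sub _ _).trans (add_le_add_left (abs_sub _ _) _)
    _ ≤ (T + a)⁻¹ * M + a⁻¹ * M + M * (a⁻¹ - (T + a)⁻¹) := by gcongr
    _ = 2 * M / a := by ring

theorem hasDerivAt_sin_mul_div {ω : ℝ} (hω : ω ≠ 0) (x : ℝ) :
    HasDerivAt (fun x => sin (ω * x) / ω) (cos (ω * x)) x := by
  refine (((hasDerivAt_id' x).const_mul ω).sin.div_const ω).congr_deriv ?_
  rw [mul_one, mul_div_cancel_right₀ _ hω]

theorem hasDerivAt_neg_cos_mul_div {ω : ℝ} (hω : ω ≠ 0) (x : ℝ) :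
    HasDerivAt (fun x => -cos (ω * x) / ω) (sin (ω * x)) x := by
  refine (((hasDerivAt_id' x).const_mul ω).cos.neg.div_const ω).congr_deriv ?_
  rw [mul_one, neg_mul, neg_neg, mul_div_cancel_right₀ _ hω]

/-- The first-order decay in `ω` that, with the factor `1/(2nπ)`, makes the Fourier coefficients of
`log Γ(x + a) - x log a` of order `1/n²`. -/
theorem abs_cos_mul_cosIntegral_add_le {a ω : ℝ} (ha : 0 < a) (hω : 0 < ω) :
    |-(cos (ω * a) * cosIntegral (ω * a)) - sin (ω * a) * sinIntegral (ω * a)|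
      ≤ 2 * (1 / ω) / a :=
  le_of_tendsto (tendsto_integral_cos_div_add ha hω).abs <| Eventually.of_forall fun N =>
    abs_integral_deriv_div_add_le ha N.cast_nonneg (hasDerivAt_sin_mul_div hω.ne') (by fun_prop)
      fun x => by
        rw [abs_div, abs_of_pos hω]
        exact div_le_div_of_nonneg_right (abs_sin_le_one _) hω.le

theorem abs_sin_mul_cosIntegral_sub_le {a ω : ℝ} (ha : 0 < a) (hω : 0 < ω) :
    |sin (ω * a) * cosIntegral (ω * a) - cos (ω * a) * sinIntegral (ω * a)|
      ≤ 2 * (1 / ω) / a :=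
  le_of_tendsto (tendsto_integral_sin_div_add ha hω).abs <| Eventually.of_forall fun N =>
    abs_integral_deriv_div_add_le ha N.cast_nonneg (hasDerivAt_neg_cos_mul_div hω.ne')
      (by fun_prop) fun x => by
        rw [abs_div, abs_of_pos hω, abs_neg]
        exact div_le_div_of_nonneg_right (abs_cos_le_one _) hω.le

/-! ### Fourier coefficients of `log Γ(x + a)` -/

theorem periodic_sin_two_nat_mul_pi (n : ℕ) :
    Function.Periodic (fun x : ℝ => sin (2 * n * π * x)) 1 := fun x => by
  simp only
  rw [← sin_add_nat_mul_two_pi (2 * n * π * x) n]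
  ring_nf

theorem periodic_cos_two_nat_mul_pi (n : ℕ) :
    Function.Periodic (fun x : ℝ => cos (2 * n * π * x)) 1 := fun x => by
  simp only
  rw [← cos_add_nat_mul_two_pi (2 * n * π * x) n]
  ring_nf

theorem integral_cos_two_nat_mul_pi {n : ℕ} (hn : 1 ≤ n) :
    ∫ x in (0 : ℝ)..1, cos (2 * n * π * x) = 0 := by
  have hω : (2 * n * π : ℝ) ≠ 0 := by positivity
  rw [intervalIntegral.integral_eq_sub_of_hasDerivAt
    (fun x _ => hasDerivAt_sin_mul_div hω x)
    ((by fun_prop : Continuous fun x => cos (2 * n * π * x)).intervalIntegrable _ _)]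
  have := periodic_sin_two_nat_mul_pi n 0
  simp only [zero_add] at this
  rw [this, sub_self]

theorem integral_sin_two_nat_mul_pi {n : ℕ} (hn : 1 ≤ n) :
    ∫ x in (0 : ℝ)..1, sin (2 * n * π * x) = 0 := by
  have hω : (2 * n * π : ℝ) ≠ 0 := by positivity
  rw [intervalIntegral.integral_eq_sub_of_hasDerivAt
    (fun x _ => hasDerivAt_neg_cos_mul_div hω x)
    ((by fun_prop : Continuous fun x => sin (2 * n * π * x)).intervalIntegrable _ _)]
  have := periodic_cos_two_nat_mul_pi n 0
  simp only [zero_add] at this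
  rw [this, sub_self]

theorem integral_log_Gamma_mul_sin {a : ℝ} (ha : 0 < a) {n : ℕ} (hn : 1 ≤ n) :
    (∫ x in (0 : ℝ)..1, log (Gamma (x + a)) * sin (2 * n * π * x)) =
      -(1 / (2 * n * π)) * (log a - cos (2 * n * π * a) * cosIntegral (2 * n * π * a)
        - sin (2 * n * π * a) * sinIntegral (2 * n * π * a)) := by
  have hω : (0 : ℝ) < 2 * n * π := by positivity
  have h1 := tendsto_integral_div_add ha (hasDerivAt_neg_cos_mul_div hω.ne') (by fun_prop)
    (periodic_sin_two_nat_mul_pi n)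
    (fun x => by simp only [periodic_cos_two_nat_mul_pi n x])
    (by rw [intervalIntegral.integral_div, intervalIntegral.integral_neg,
      integral_cos_two_nat_mul_pi hn, neg_zero, zero_div])
  have h2 := (tendsto_integral_cos_div_add ha hω).const_mul (-(1 / (2 * n * π)))
  have h3 := tendsto_nhds_unique h1 (h2.congr fun N => by
    rw [← intervalIntegral.integral_const_mul]
    exact intervalIntegral.integral_congr fun x _ => by ring)
  rw [mul_zero, cos_zero, sub_eq_iff_eq_add] at h3
  rw [h3]
  ring

theorem integral_log_Gamma_mul_cos {a : ℝ} (ha : 0 < a) {n : ℕ} (hn : 1 ≤ n) :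
    (∫ x in (0 : ℝ)..1, log (Gamma (x + a)) * cos (2 * n * π * x)) =
      -(1 / (2 * n * π)) * (-(sin (2 * n * π * a) * cosIntegral (2 * n * π * a))
        + cos (2 * n * π * a) * sinIntegral (2 * n * π * a)) := by
  have hω : (0 : ℝ) < 2 * n * π := by positivity
  have h1 := tendsto_integral_div_add ha (hasDerivAt_sin_mul_div hω.ne') (by fun_prop)
    (periodic_cos_two_nat_mul_pi n)
    (fun x => by simp only [periodic_sin_two_nat_mul_pi n x])
    (by rw [intervalIntegral.integral_div, integral_sin_two_nat_mul_pi hn, zero_div])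
  have h2 := (tendsto_integral_sin_div_add ha hω).const_mul (1 / (2 * n * π))
  have h3 := tendsto_nhds_unique h1 (h2.congr fun N => by
    rw [← intervalIntegral.integral_const_mul]
    exact intervalIntegral.integral_congr fun x _ => by ring)
  rw [mul_zero, sin_zero, zero_div, zero_mul, sub_zero] at h3
  rw [h3]
  ring

/-! ### The mean value of `log Γ` -/

/-- At `0` the singularity of `log Γ(x) = log Γ(x + 1) - log x` is only logarithmic. -/
theorem intervalIntegrable_log_Gamma {b c : ℝ} (hb : 0 ≤ b) (hc : 0 ≤ c) :
    IntervalIntegrable (fun x : ℝ => log (Gamma x)) MeasureTheory.volume b c := by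
  have h1 : IntervalIntegrable (fun x : ℝ => log (Gamma (x + 1)) - log x)
      MeasureTheory.volume b c := by
    refine (ContinuousOn.intervalIntegrable (continuousOn_log_Gamma_add fun x hx => ?_)).sub
      intervalIntegral.intervalIntegrable_log'
    have := (le_min hb hc).trans hx.1
    linarith
  refine h1.congr fun x hx => ?_
  have : 0 < x := (le_min hb hc).trans_lt hx.1
  simp only [log_Gamma_add_one this, add_sub_cancel_right]

/-- **Raabe's integral**. Euler's reflection formula reduces it to `∫ log (sin x)` over `[0, π]`. -/
theorem integral_log_Gamma_zero_one :
    ∫ x in (0 : ℝ)..1, log (Gamma x) = 1 / 2 * log (2 * π) := by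
  have hi := intervalIntegrable_log_Gamma le_rfl zero_le_one
  have hi' : IntervalIntegrable (fun x : ℝ => log (Gamma (1 - x))) MeasureTheory.volume 0 1 := by
    simpa using (hi.comp_sub_left 1).symm
  have hrefl : ∫ x in (0 : ℝ)..1, log (Gamma (1 - x)) = ∫ x in (0 : ℝ)..1, log (Gamma x) := by
    simpa using intervalIntegral.integral_comp_sub_left (a := 0) (b := 1)
      (fun x => log (Gamma x)) 1
  have hs : ∫ x in (0 : ℝ)..1, log (sin (π * x)) = -log 2 := by
    have := intervalIntegral.integral_comp_mul_left (a := 0) (b := 1) (fun x => log (sin x))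
      pi_ne_zero
    rw [this, mul_zero, mul_one, integral_log_sin_zero_pi, smul_eq_mul]
    field_simp
  have hsi : IntervalIntegrable (fun x => log (sin (π * x))) MeasureTheory.volume 0 1 := by
    -- the integral of a non-integrable function is `0` by convention, which `-log 2` is not
    by_contra h
    rw [intervalIntegral.integral_undef h] at hs
    have := log_pos one_lt_two
    linarith
  have hsum := intervalIntegral.integral_add hi hi'
  have hcongr : ∫ x in (0 : ℝ)..1, (log (Gamma x) + log (Gamma (1 - x)))
      = ∫ x in (0 : ℝ)..1, (log π - log (sin (π * x))) := by
    refine intervalIntegral.integral_congr_Ioo_of_le zero_le_one fun x hx => ?_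
    have hsin : 0 < sin (π * x) :=
      sin_pos_of_pos_of_lt_pi (mul_pos pi_pos hx.1) (mul_lt_of_lt_one_right pi_pos hx.2)
    rw [← log_mul (Gamma_pos_of_pos hx.1).ne' (Gamma_pos_of_pos (sub_pos.2 hx.2)).ne',
      Gamma_mul_Gamma_one_sub, log_div pi_ne_zero hsin.ne']
  rw [hcongr, intervalIntegral.integral_sub (by simp) hsi, hs, hrefl] at hsum
  rw [log_mul two_ne_zero pi_ne_zero]
  simp only [intervalIntegral.integral_const, sub_zero, smul_eq_mul, one_mul] at hsum
  linarith

/-- Integrating `log Γ(x + 1) - log Γ(x) = log x` over `[0, a]` compares the mean over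
`[a, a + 1]` with Raabe's integral. -/
theorem integral_log_Gamma_add {a : ℝ} (ha : 0 ≤ a) :
    ∫ x in (0 : ℝ)..1, log (Gamma (a + x)) = 1 / 2 * log (2 * π) + a * log a - a := by
  have h1 := intervalIntegral.integral_comp_add_left (a := 0) (b := 1)
    (fun x => log (Gamma x)) a
  have h2 := intervalIntegral.integral_comp_add_right (a := 0) (b := a)
    (fun x => log (Gamma x)) 1
  have h3 : ∫ x in (0 : ℝ)..a, log (Gamma (x + 1))
      = ∫ x in (0 : ℝ)..a, (log (Gamma x) + log x) := by
    refine intervalIntegral.integral_congr_Ioo_of_le ha fun x hx => ?_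
    exact log_Gamma_add_one hx.1
  rw [intervalIntegral.integral_add (intervalIntegrable_log_Gamma le_rfl ha)
    intervalIntegral.intervalIntegrable_log', integral_log] at h3
  have h4 := intervalIntegral.integral_add_adjacent_intervals
    (intervalIntegrable_log_Gamma le_rfl ha)
    (intervalIntegrable_log_Gamma ha (add_nonneg ha zero_le_one))
  have h5 := intervalIntegral.integral_add_adjacent_intervals
    (intervalIntegrable_log_Gamma le_rfl zero_le_one)
    (intervalIntegrable_log_Gamma zero_le_one (add_nonneg ha zero_le_one))
  rw [integral_log_Gamma_zero_one] at h5
  rw [add_zero] at h1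
  rw [zero_add] at h2
  simp only [zero_mul, sub_zero, add_zero] at h3
  linarith

/-! ### Pointwise convergence of Fourier series -/

/-- Dirichlet kernel identity, multiplied out so as to hold also at the zeros of `sin`. -/
theorem sin_mul_one_add_two_mul_sum_cos (N : ℕ) (y : ℝ) :
    sin y * (1 + 2 * ∑ n ∈ Finset.Icc 1 N, cos (2 * n * y)) = sin ((2 * N + 1) * y) := by
  induction N with
  | zero => simp
  | succ N ih =>
    rw [Finset.sum_Icc_succ_top (by omega), mul_add 2, ← add_assoc, mul_add, ih]
    push_cast
    rw [show (2 * (N : ℝ) + 1) * y = 2 * (N + 1) * y - y by ring,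
      show (2 * ((N : ℝ) + 1) + 1) * y = 2 * (N + 1) * y + y by ring, sin_sub, sin_add]
    ring

/-- The Fourier series of the sawtooth. The derivative of the `N`-th partial sum minus `1/2 - x` is
the quotient `sin ((2N+1)πx) / sin (πx)`; adding the correction
`cos ((2N+1)πx) / ((2N+1)π sin (πx))` leaves a function that vanishes at `1/2` and whose derivative
is `O(1/N)` on compact subintervals of `(0, 1)`. -/
theorem tendsto_sum_sin_div_sawtooth {x : ℝ} (h0 : 0 < x) (h1 : x < 1) :
    Tendsto (fun N : ℕ => ∑ n ∈ Finset.Icc 1 N, sin (2 * n * π * x) / (n * π)) atTop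
      (𝓝 (1 / 2 - x)) := by
  set s : Set ℝ := Set.uIcc (1 / 2) x with hs
  have hsin : ∀ t ∈ s, 0 < sin (π * t) := fun t ht => by
    have ht' : t ∈ Set.Ioo (0 : ℝ) 1 :=
      Set.OrdConnected.uIcc_subset (Set.ordConnected_Ioo) (by norm_num) ⟨h0, h1⟩ ht
    exact sin_pos_of_pos_of_lt_pi (mul_pos pi_pos ht'.1) (mul_lt_of_lt_one_right pi_pos ht'.2)
  obtain ⟨K, hK⟩ := isCompact_uIcc.exists_bound_of_continuousOn
    (show ContinuousOn (fun t => (sin (π * t) ^ 2)⁻¹) s from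
      ContinuousOn.inv₀ (by fun_prop) fun t ht => (pow_pos (hsin t ht) 2).ne')
  have hmem : x ∈ s := Set.right_mem_uIcc
  let F : ℕ → ℝ → ℝ := fun N t => (∑ n ∈ Finset.Icc 1 N, sin (2 * n * π * t) / (n * π))
    - (1 / 2 - t) + cos ((2 * N + 1) * (π * t)) / ((2 * N + 1) * π * sin (π * t))
  have hF : ∀ N : ℕ, ∀ t ∈ s, HasDerivAt (F N)
      (-(cos ((2 * N + 1) * (π * t)) * cos (π * t)) / ((2 * N + 1) * sin (π * t) ^ 2)) t := by
    intro N t ht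
    have hst := (hsin t ht).ne'
    have hN : (2 * (N : ℝ) + 1) ≠ 0 := by positivity
    have hsum : HasDerivAt (fun t => ∑ n ∈ Finset.Icc 1 N, sin (2 * n * π * t) / (n * π))
        (∑ n ∈ Finset.Icc 1 N, 2 * cos (2 * n * (π * t))) t := by
      refine HasDerivAt.fun_sum fun n hn => ?_
      have hn0 : (n : ℝ) ≠ 0 := by
        have := (Finset.mem_Icc.1 hn).1
        positivity
      refine (((hasDerivAt_id' t).const_mul (2 * n * π)).sin.div_const (n * π)).congr_deriv ?_
      rw [mul_assoc (2 * (n : ℝ))]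
      field_simp
    have hπ : HasDerivAt (fun t : ℝ => π * t) π t := by
      simpa using (hasDerivAt_id' t).const_mul π
    have hc := (hπ.const_mul (2 * (N : ℝ) + 1)).cos
    have hd := hπ.sin.const_mul ((2 * (N : ℝ) + 1) * π)
    have hq := hc.div hd (by positivity)
    have hD := sin_mul_one_add_two_mul_sum_cos N (π * t)
    refine ((hsum.sub ((hasDerivAt_id' t).const_sub (1 / 2))).add hq).congr_deriv ?_
    rw [← Finset.mul_sum]
    have hD' : 2 * ∑ n ∈ Finset.Icc 1 N, cos (2 * n * (π * t))
        = sin ((2 * N + 1) * (π * t)) / sin (π * t) - 1 := by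
      rw [← hD, mul_div_cancel_left₀ _ hst]
      ring
    rw [hD']
    field_simp
    ring
  have hhalf : ∀ N : ℕ, F N (1 / 2) = 0 := by
    intro N
    have e1 : ∀ n : ℕ, sin (2 * n * π * (1 / 2)) = 0 := fun n => by
      rw [← sin_nat_mul_pi n]; ring_nf
    have e2 : cos ((2 * N + 1) * (π * (1 / 2))) = 0 :=
      cos_eq_zero_iff.2 ⟨N, by push_cast; ring⟩
    simp only [F, e1, e2, zero_div, Finset.sum_const_zero, sub_self, add_zero]
  have hbound : ∀ N : ℕ, ‖F N x‖ ≤ K / (2 * N + 1) * ‖x - 1 / 2‖ := by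
    intro N
    have := (convex_uIcc (1 / 2 : ℝ) x).norm_image_sub_le_of_norm_hasDerivWithin_le
      (fun t ht => (hF N t ht).hasDerivWithinAt) (C := K / (2 * N + 1)) (fun t ht => ?_)
      Set.left_mem_uIcc Set.right_mem_uIcc
    · rwa [hhalf, sub_zero] at this
    · have hN : 0 < (2 * (N : ℝ) + 1) := by positivity
      rw [norm_div, norm_neg, norm_mul, norm_mul, Real.norm_of_nonneg hN.le,
        mul_comm (2 * (N : ℝ) + 1) ‖_‖, ← div_div]
      refine div_le_div_of_nonneg_right ?_ hN.le
      rw [div_eq_mul_inv, ← norm_inv]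
      have hcc : ‖cos ((2 * N + 1) * (π * t))‖ * ‖cos (π * t)‖ ≤ 1 :=
        mul_le_one₀ (abs_cos_le_one _) (norm_nonneg _) (abs_cos_le_one _)
      exact (mul_le_of_le_one_left (norm_nonneg _) hcc).trans (hK t ht)
  have hN : Tendsto (fun N : ℕ => (2 * (N : ℝ) + 1)) atTop atTop :=
    tendsto_atTop_add_const_right _ _ (tendsto_natCast_atTop_atTop.const_mul_atTop two_pos)
  have hF0 : Tendsto (fun N => F N x) atTop (𝓝 0) := by
    refine squeeze_zero_norm hbound ?_
    simpa using (tendsto_const_nhds.div_atTop hN).mul_const ‖x - 1 / 2‖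
  have hcorr : Tendsto (fun N : ℕ => cos ((2 * N + 1) * (π * x)) / ((2 * N + 1) * π * sin (π * x)))
      atTop (𝓝 0) := by
    have hd : Tendsto (fun N : ℕ => 1 / ((2 * (N : ℝ) + 1) * (π * sin (π * x)))) atTop (𝓝 0) :=
      tendsto_const_nhds.div_atTop (hN.atTop_mul_const (mul_pos pi_pos (hsin x hmem)))
    refine squeeze_zero_norm (fun N => ?_) hd
    have hpos : 0 < (2 * (N : ℝ) + 1) * (π * sin (π * x)) := by
      have := hsin x hmem
      positivity
    rw [norm_div, mul_assoc, Real.norm_of_nonneg hpos.le]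
    exact div_le_div_of_nonneg_right (abs_cos_le_one _) hpos.le
  have := (hF0.sub hcorr).add_const (1 / 2 - x)
  rw [sub_zero, zero_add] at this
  refine this.congr fun N => ?_
  simp only [F]
  ring

/-- Pointwise convergence of the real Fourier series of a continuous function on the circle
`[0, 1] / (0 ∼ 1)` whose coefficients are `O(1/n²)`. -/
theorem tendsto_sum_fourier_of_coeff_le {f : ℝ → ℝ} (hf : ContinuousOn f (Set.Icc 0 1))
    (hend : f 0 = f 1) {M : ℝ}
    (hcos : ∀ n : ℕ, 1 ≤ n → |∫ t in (0 : ℝ)..1, f t * cos (2 * n * π * t)| ≤ M / n ^ 2)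
    (hsin : ∀ n : ℕ, 1 ≤ n → |∫ t in (0 : ℝ)..1, f t * sin (2 * n * π * t)| ≤ M / n ^ 2)
    {x : ℝ} (hx : x ∈ Set.Ico (0 : ℝ) 1) :
    Tendsto (fun N : ℕ => ∑ n ∈ Finset.Icc 1 N,
        2 * ((∫ t in (0 : ℝ)..1, f t * cos (2 * n * π * t)) * cos (2 * n * π * x)
          + (∫ t in (0 : ℝ)..1, f t * sin (2 * n * π * t)) * sin (2 * n * π * x)))
      atTop (𝓝 (f x - ∫ t in (0 : ℝ)..1, f t)) := by
  -- the coefficients as functions of a real index, even and odd, so as to cover negative `n`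
  let A : ℝ → ℝ := fun r => ∫ t in (0 : ℝ)..1, f t * cos (2 * r * π * t)
  let B : ℝ → ℝ := fun r => ∫ t in (0 : ℝ)..1, f t * sin (2 * r * π * t)
  have hA : ∀ r, A (-r) = A r := fun r => by
    simp only [A, mul_neg, neg_mul, cos_neg]
  have hB : ∀ r, B (-r) = -B r := fun r => by
    simp only [B, mul_neg, neg_mul, sin_neg, intervalIntegral.integral_neg]
  let g : C(AddCircle (1 : ℝ), ℂ) :=
    ContinuousMap.mk (AddCircle.liftIco 1 0 (fun t => (f t : ℂ)))
      (AddCircle.liftIco_zero_continuous (by rw [hend])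
        (Complex.continuous_ofReal.comp_continuousOn hf))
  have hint : ∀ h : ℝ → ℝ, Continuous h →
      IntervalIntegrable (fun t => ((f t * h t : ℝ) : ℂ)) MeasureTheory.volume 0 1 := fun h hh =>
    ContinuousOn.intervalIntegrable (Complex.continuous_ofReal.comp_continuousOn
      ((hf.mono (by rw [Set.uIcc_of_le zero_le_one])).mul hh.continuousOn))
  have hcoeff : ∀ n : ℤ, fourierCoeff g n = (A n : ℂ) - (B n : ℂ) * Complex.I := by
    intro n
    simp only [g, ContinuousMap.coe_mk]
    rw [fourierCoeff_liftIco_eq, fourierCoeffOn_eq_integral]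
    have e : ∀ t : ℝ, fourier (-n) (t : AddCircle ((0 : ℝ) + 1 - 0)) • (f t : ℂ)
        = ((f t * cos (2 * n * π * t) : ℝ) : ℂ) - ((f t * sin (2 * n * π * t) : ℝ) : ℂ)
          * Complex.I := by
      intro t
      rw [fourier_coe_apply, show 2 * (π : ℂ) * Complex.I * ((-n : ℤ) : ℂ) * t
        / ((0 + 1 - 0 : ℝ) : ℂ) = ((-(2 * n * π * t) : ℝ) : ℂ) * Complex.I by push_cast; ring,
        Complex.exp_mul_I, ← Complex.ofReal_cos, ← Complex.ofReal_sin, cos_neg, sin_neg]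
      push_cast
      simp only [smul_eq_mul]
      ring
    simp only [e]
    rw [zero_add, intervalIntegral.integral_sub, intervalIntegral.integral_mul_const,
      intervalIntegral.integral_ofReal, intervalIntegral.integral_ofReal]
    · simp [A, B]
    · exact hint (fun t => cos (2 * n * π * t)) (by fun_prop)
    · exact (hint (fun t => sin (2 * n * π * t)) (by fun_prop)).mul_const _
  have hsummable : Summable (fourierCoeff g) := by
    refine Summable.of_norm_bounded_eventually
      ((Real.summable_one_div_int_pow (p := 2)).2 one_lt_two |>.mul_left (2 * M)) ?_
    filter_upwards [(Set.finite_singleton (0 : ℤ)).compl_mem_cofinite] with n hn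
    have hn1 : 1 ≤ n.natAbs := Int.natAbs_pos.2 hn
    have hAB : |A n| ≤ M / (n : ℝ) ^ 2 ∧ |B n| ≤ M / (n : ℝ) ^ 2 := by
      have h1 := hcos _ hn1
      have h2 := hsin _ hn1
      rcases Int.natAbs_eq n with h | h
      · have hc : (n : ℝ) = (n.natAbs : ℝ) := by
          simpa only [Int.cast_neg, Int.cast_natCast] using congrArg (Int.cast (R := ℝ)) h
        rw [hc]
        exact ⟨h1, h2⟩
      · have hc : (n : ℝ) = -(n.natAbs : ℝ) := by
          simpa only [Int.cast_neg, Int.cast_natCast] using congrArg (Int.cast (R := ℝ)) h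
        rw [hc, hA, hB, abs_neg, neg_sq]
        exact ⟨h1, h2⟩
    rw [hcoeff]
    refine (norm_sub_le _ _).trans ?_
    rw [norm_mul, Complex.norm_I, mul_one, Complex.norm_real, Complex.norm_real]
    refine (add_le_add hAB.1 hAB.2).trans (le_of_eq ?_)
    ring
  have hsum := (has_pointwise_sum_fourier_series_of_summable hsummable
    (x : AddCircle (1 : ℝ))).nat_add_neg
  have hterm : ∀ n : ℕ, fourierCoeff g n • fourier n (x : AddCircle (1 : ℝ))
      + fourierCoeff g (-n) • fourier (-n) (x : AddCircle (1 : ℝ))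
      = ((2 * (A n * cos (2 * n * π * x) + B n * sin (2 * n * π * x)) : ℝ) : ℂ) := by
    intro n
    have e : ∀ m : ℤ, fourier m (x : AddCircle (1 : ℝ))
        = (cos (2 * m * π * x) : ℂ) + (sin (2 * m * π * x) : ℂ) * Complex.I := by
      intro m
      rw [fourier_coe_apply, show 2 * (π : ℂ) * Complex.I * (m : ℂ) * x
        / ((1 : ℝ) : ℂ) = ((2 * m * π * x : ℝ) : ℂ) * Complex.I by push_cast; ring,
        Complex.exp_mul_I, ← Complex.ofReal_cos, ← Complex.ofReal_sin]
    rw [hcoeff, hcoeff, e, e]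
    push_cast
    rw [hA, hB]
    simp only [mul_neg, neg_mul, Complex.cos_neg, Complex.sin_neg]
    push_cast
    linear_combination (-2 * (B n : ℂ) * Complex.sin (2 * n * π * x)) * Complex.I_sq
  have hA0 : A 0 = ∫ t in (0 : ℝ)..1, f t := by simp [A]
  have hB0 : B 0 = 0 := by simp [B]
  have hg0 : fourierCoeff g 0 • fourier 0 (x : AddCircle (1 : ℝ)) = ((A 0 : ℝ) : ℂ) := by
    rw [hcoeff]
    simp [hB0]
  have hgx : g (x : AddCircle (1 : ℝ)) = (f x : ℂ) :=
    AddCircle.liftIco_zero_coe_apply (f := fun t => (f t : ℂ)) hx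
  simp only [hterm] at hsum
  rw [hg0, hgx, ← Complex.ofReal_add, Complex.hasSum_ofReal] at hsum
  -- pairing `n` with `-n` counts the constant term twice
  have hlim := (hsum.tendsto_sum_nat.comp (tendsto_add_atTop_nat 1)).sub_const (2 * A 0)
  rw [show f x + A 0 - 2 * A 0 = f x - A 0 by ring, hA0] at hlim
  refine hlim.congr fun N => ?_
  rw [Function.comp_apply, Finset.range_eq_Ico, Finset.sum_eq_sum_Ico_succ_bot (Nat.succ_pos N)]
  simp only [Nat.cast_zero, hB0, mul_zero, zero_mul, cos_zero, mul_one, add_zero, hA0, zero_add,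
    add_sub_cancel_left]
  rfl

/-! ### Fourier expansions of `log Γ(a + x)` -/

theorem integral_mul_sin_two_nat_mul_pi {n : ℕ} (hn : 1 ≤ n) :
    ∫ x in (0 : ℝ)..1, x * sin (2 * n * π * x) = -(1 / (2 * n * π)) := by
  have hω : (2 * n * π : ℝ) ≠ 0 := by positivity
  rw [intervalIntegral.integral_mul_deriv_eq_deriv_mul (u := fun x : ℝ => x) (u' := fun _ => 1)
    (fun x _ => hasDerivAt_id' x) (fun x _ => hasDerivAt_neg_cos_mul_div hω x) (by simp)
    ((by fun_prop : Continuous fun x => sin (2 * n * π * x)).intervalIntegrable _ _)]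
  have h1 := periodic_cos_two_nat_mul_pi n 0
  simp only [zero_add, mul_zero, cos_zero] at h1
  simp only [one_mul, intervalIntegral.integral_div, intervalIntegral.integral_neg,
    integral_cos_two_nat_mul_pi hn, h1]
  ring

theorem integral_mul_cos_two_nat_mul_pi {n : ℕ} (hn : 1 ≤ n) :
    ∫ x in (0 : ℝ)..1, x * cos (2 * n * π * x) = 0 := by
  have hω : (2 * n * π : ℝ) ≠ 0 := by positivity
  rw [intervalIntegral.integral_mul_deriv_eq_deriv_mul (u := fun x : ℝ => x) (u' := fun _ => 1)
    (fun x _ => hasDerivAt_id' x) (fun x _ => hasDerivAt_sin_mul_div hω x) (by simp)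
    ((by fun_prop : Continuous fun x => cos (2 * n * π * x)).intervalIntegrable _ _)]
  have h1 := periodic_sin_two_nat_mul_pi n 0
  simp only [zero_add, mul_zero, sin_zero] at h1
  simp only [one_mul, intervalIntegral.integral_div, integral_sin_two_nat_mul_pi hn, h1]
  ring

/-- The series of `log Γ(a + x)` with the sawtooth part summed. Subtracting `x log a` gives
`log Γ(x + a) - x log a`, which takes equal values at `0` and `1` and has Fourier coefficients
`O(1/n²)`, so its Fourier series converges to it even at the endpoint `x = 0`. -/
theorem tendsto_sum_log_Gamma_add {a : ℝ} (ha : 0 < a) {x : ℝ} (hx : x ∈ Set.Ico (0 : ℝ) 1) :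
    Tendsto (fun N : ℕ => ∑ n ∈ Finset.Icc 1 N,
        (sin (2 * n * π * (a + x)) * cosIntegral (2 * n * π * a)
          - cos (2 * n * π * (a + x)) * sinIntegral (2 * n * π * a)) / (n * π)) atTop
      (𝓝 (log (Gamma (a + x)) - (1 / 2 * log (2 * π) + (a + x - 1 / 2) * log a - a))) := by
  have hΓc : ContinuousOn (fun t : ℝ => log (Gamma (t + a))) (Set.Icc 0 1) :=
    continuousOn_log_Gamma_add fun t ht => by linarith [ht.1]
  have hint : ∀ h : ℝ → ℝ, Continuous h →
      IntervalIntegrable (fun t => log (Gamma (t + a)) * h t) MeasureTheory.volume 0 1 :=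
    fun h hh =>
    ContinuousOn.intervalIntegrable
      ((hΓc.mono (by rw [Set.uIcc_of_le zero_le_one])).mul hh.continuousOn)
  have hsplit : ∀ h : ℝ → ℝ, Continuous h →
      ∫ t in (0 : ℝ)..1, (log (Gamma (t + a)) - t * log a) * h t
        = (∫ t in (0 : ℝ)..1, log (Gamma (t + a)) * h t)
          - log a * ∫ t in (0 : ℝ)..1, t * h t := fun h hh => by
    rw [← intervalIntegral.integral_const_mul, ← intervalIntegral.integral_sub (hint h hh)
      ((by fun_prop : Continuous fun t => log a * (t * h t)).intervalIntegrable _ _)]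
    exact intervalIntegral.integral_congr fun t _ => by ring
  have hmean : ∫ t in (0 : ℝ)..1, (log (Gamma (t + a)) - t * log a)
      = 1 / 2 * log (2 * π) + (a - 1 / 2) * log a - a := by
    have h1 := hsplit (fun _ => 1) continuous_const
    have h2 := integral_log_Gamma_add ha.le
    simp only [add_comm a] at h2
    simp only [mul_one, h2, integral_id] at h1
    rw [h1]
    ring
  have hcosc : ∀ n : ℕ, 1 ≤ n →
      ∫ t in (0 : ℝ)..1, (log (Gamma (t + a)) - t * log a) * cos (2 * n * π * t)
        = 1 / (2 * n * π) * (sin (2 * n * π * a) * cosIntegral (2 * n * π * a)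
          - cos (2 * n * π * a) * sinIntegral (2 * n * π * a)) := fun n hn => by
    rw [hsplit _ (by fun_prop), integral_log_Gamma_mul_cos ha hn,
      integral_mul_cos_two_nat_mul_pi hn]
    ring
  have hsinc : ∀ n : ℕ, 1 ≤ n →
      ∫ t in (0 : ℝ)..1, (log (Gamma (t + a)) - t * log a) * sin (2 * n * π * t)
        = -(1 / (2 * n * π)) * (-(cos (2 * n * π * a) * cosIntegral (2 * n * π * a))
          - sin (2 * n * π * a) * sinIntegral (2 * n * π * a)) := fun n hn => by
    rw [hsplit _ (by fun_prop), integral_log_Gamma_mul_sin ha hn,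
      integral_mul_sin_two_nat_mul_pi hn]
    ring
  have hconst : ∀ n : ℕ, 1 ≤ n → 1 / (2 * n * π) * (2 * (1 / (2 * n * π)) / a)
      = 1 / (2 * π ^ 2 * a) / (n : ℝ) ^ 2 := fun n hn => by
    have : (n : ℝ) ≠ 0 := by positivity
    field_simp
  have h := tendsto_sum_fourier_of_coeff_le (f := fun t => log (Gamma (t + a)) - t * log a)
    (M := 1 / (2 * π ^ 2 * a)) (hΓc.sub (by fun_prop))
    (by
      simp only [zero_add, add_comm (1 : ℝ) a]
      rw [log_Gamma_add_one ha]
      ring)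
    (fun n hn => by
      have hω : (0 : ℝ) < 2 * n * π := by positivity
      rw [hcosc n hn, abs_mul, abs_of_pos (by positivity), ← hconst n hn]
      exact mul_le_mul_of_nonneg_left (abs_sin_mul_cosIntegral_sub_le ha hω) (by positivity))
    (fun n hn => by
      have hω : (0 : ℝ) < 2 * n * π := by positivity
      rw [hsinc n hn, abs_mul, abs_neg, abs_of_pos (by positivity), ← hconst n hn]
      exact mul_le_mul_of_nonneg_left (abs_cos_mul_cosIntegral_add_le ha hω) (by positivity))
    hx
  rw [hmean] at h
  rw [add_comm a x]
  convert h using 2 with N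
  · refine Finset.sum_congr rfl fun n hn => ?_
    have hn1 := (Finset.mem_Icc.1 hn).1
    have hn0 : (n : ℝ) ≠ 0 := by positivity
    rw [hcosc n hn1, hsinc n hn1, mul_add (2 * n * π : ℝ) x a, sin_add, cos_add]
    field_simp
    ring
  · ring

/-- The cosine series converges absolutely: its `n`-th term is `O(1/n²)`. -/
theorem exists_tendsto_sum_cos {a : ℝ} (ha : 0 < a) (x : ℝ) :
    ∃ C : ℝ, Tendsto (fun N : ℕ => ∑ n ∈ Finset.Icc 1 N,
      1 / (n * π) * (-(sin (2 * n * π * a) * cosIntegral (2 * n * π * a))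
        + cos (2 * n * π * a) * sinIntegral (2 * n * π * a)) * cos (2 * n * π * x))
      atTop (𝓝 C) := by
  set u : ℕ → ℝ := fun n => 1 / (n * π) * (-(sin (2 * n * π * a) * cosIntegral (2 * n * π * a))
        + cos (2 * n * π * a) * sinIntegral (2 * n * π * a)) * cos (2 * n * π * x)
  have hu : ∀ n, ‖u n‖ ≤ 1 / (π ^ 2 * a) * (1 / (n : ℝ) ^ 2) := by
    intro n
    rcases Nat.eq_zero_or_pos n with rfl | hn
    · simp [u]
    have hω : (0 : ℝ) < 2 * n * π := by positivity
    have hb := abs_sin_mul_cosIntegral_sub_le ha hω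
    rw [← abs_neg, neg_sub, sub_eq_neg_add] at hb
    have hp : (0 : ℝ) ≤ 1 / (n * π) := by positivity
    simp only [u, norm_mul, Real.norm_eq_abs, abs_of_nonneg hp]
    refine (mul_le_of_le_one_right (by positivity) (abs_cos_le_one _)).trans
      ((mul_le_mul_of_nonneg_left hb hp).trans (le_of_eq ?_))
    have hn0 : (n : ℝ) ≠ 0 := by positivity
    field_simp
  have hs : Summable u := Summable.of_norm_bounded
    ((Real.summable_one_div_nat_pow (p := 2)).2 one_lt_two |>.mul_left _) hu
  have hlim := hs.hasSum.tendsto_sum_nat.comp (tendsto_add_atTop_nat 1)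
  refine ⟨_, hlim.congr fun N => ?_⟩
  rw [Function.comp_apply, Finset.range_eq_Ico, Finset.sum_eq_sum_Ico_succ_bot (Nat.succ_pos N)]
  simp only [u, Nat.cast_zero, zero_mul, div_zero, zero_add]
  rfl

theorem mainTheorem1 (a : ℝ) (ha : 0 < a) :
    -- the sine and cosine coefficients of `log Γ(x + a)` on `[0, 1]`
    (∀ n : ℕ, 1 ≤ n →
      (∫ x in (0 : ℝ)..1, Real.log (Real.Gamma (x + a)) * Real.sin (2 * n * π * x)) =
        -(1 / (2 * n * π)) * (Real.log a
          - Real.cos (2 * n * π * a) * cosIntegral (2 * n * π * a)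
          - Real.sin (2 * n * π * a) * sinIntegral (2 * n * π * a)) ∧
      (∫ x in (0 : ℝ)..1, Real.log (Real.Gamma (x + a)) * Real.cos (2 * n * π * x)) =
        -(1 / (2 * n * π)) *
          (-(Real.sin (2 * n * π * a) * cosIntegral (2 * n * π * a))
            + Real.cos (2 * n * π * a) * sinIntegral (2 * n * π * a))) ∧
    -- Raabe's integral and the mean value of `log Γ(a + x)` on `[0, 1]`
    (IntervalIntegrable (fun x : ℝ => Real.log (Real.Gamma x)) MeasureTheory.volume 0 1 ∧
      (∫ x in (0 : ℝ)..1, Real.log (Real.Gamma x)) = 1 / 2 * Real.log (2 * π)) ∧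
    (IntervalIntegrable (fun x : ℝ => Real.log (Real.Gamma (a + x))) MeasureTheory.volume 0 1 ∧
      (∫ x in (0 : ℝ)..1, Real.log (Real.Gamma (a + x))) =
        1 / 2 * Real.log (2 * π) + a * Real.log a - a) ∧
    (∀ x : ℝ, 0 < x → x < 1 →
      -- the Fourier series of `log Γ(a + x)`: a convergent cosine and a convergent sine series
      (∃ C S : ℝ,
        Tendsto (fun N : ℕ => ∑ n ∈ Finset.Icc 1 N,
          1 / (n * π) * (-(Real.sin (2 * n * π * a) * cosIntegral (2 * n * π * a))
            + Real.cos (2 * n * π * a) * sinIntegral (2 * n * π * a))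
            * Real.cos (2 * n * π * x)) atTop (𝓝 C) ∧
        Tendsto (fun N : ℕ => ∑ n ∈ Finset.Icc 1 N,
          1 / (n * π) * (Real.log a
            - Real.cos (2 * n * π * a) * cosIntegral (2 * n * π * a)
            - Real.sin (2 * n * π * a) * sinIntegral (2 * n * π * a))
            * Real.sin (2 * n * π * x)) atTop (𝓝 S) ∧
        Real.log (Real.Gamma (a + x)) =
          1 / 2 * Real.log (2 * π) + a * Real.log a - a - C - S) ∧
      -- the compact form
      (∃ L : ℝ,
        Tendsto (fun N : ℕ => ∑ n ∈ Finset.Icc 1 N,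
          (Real.sin (2 * n * π * (a + x)) * cosIntegral (2 * n * π * a)
            - Real.cos (2 * n * π * (a + x)) * sinIntegral (2 * n * π * a)) / (n * π))
          atTop (𝓝 L) ∧
        Real.log (Real.Gamma (a + x)) =
          1 / 2 * Real.log (2 * π) + (a + x - 1 / 2) * Real.log a - a + L)) ∧
    -- the compact form at `x = 0`
    (∃ L : ℝ,
      Tendsto (fun N : ℕ => ∑ n ∈ Finset.Icc 1 N,
        (Real.sin (2 * n * π * a) * cosIntegral (2 * n * π * a)
          - Real.cos (2 * n * π * a) * sinIntegral (2 * n * π * a)) / (n * π))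
        atTop (𝓝 L) ∧
      Real.log (Real.Gamma a) =
        1 / 2 * Real.log (2 * π) + (a - 1 / 2) * Real.log a - a + L) := by
  refine ⟨fun n hn => ⟨integral_log_Gamma_mul_sin ha hn, integral_log_Gamma_mul_cos ha hn⟩,
    ⟨intervalIntegrable_log_Gamma le_rfl zero_le_one, integral_log_Gamma_zero_one⟩,
    ⟨?_, integral_log_Gamma_add ha.le⟩, fun x hx0 hx1 => ⟨?_, ?_⟩, ?_⟩
  · simpa only [add_comm a] using ContinuousOn.intervalIntegrable
      (continuousOn_log_Gamma_add (a := a) fun x hx => by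
        rw [Set.uIcc_of_le zero_le_one] at hx
        linarith [hx.1])
  · obtain ⟨C, hC⟩ := exists_tendsto_sum_cos ha x
    have hL := tendsto_sum_log_Gamma_add ha (x := x) ⟨hx0.le, hx1⟩
    have hW := (tendsto_sum_sin_div_sawtooth hx0 hx1).const_mul (log a)
    -- the sine series is `log a` times the sawtooth, minus the compact series and the cosine series
    refine ⟨C, _, hC, ((hW.sub hL).sub hC).congr fun N => ?_, by ring⟩
    rw [Finset.mul_sum, ← Finset.sum_sub_distrib, ← Finset.sum_sub_distrib]
    refine Finset.sum_congr rfl fun n _ => ?_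
    rw [mul_add (2 * n * π : ℝ) a x, sin_add, cos_add]
    ring
  · exact ⟨_, tendsto_sum_log_Gamma_add ha ⟨hx0.le, hx1⟩, by ring⟩
  · have h := tendsto_sum_log_Gamma_add ha (x := 0) ⟨le_rfl, one_pos⟩
    simp only [add_zero] at h
    exact ⟨_, h, by ring⟩
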